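/- Let $G$ be a finite simple graph. For $k\ge 1$ let $P_k$ denote the path with $k$ vertices. Suppose that $G$ can be $(s,t)$-covered, that is, $G$ contains $s$ copies of $P_2$ and $t$ copies of $P_3$ as (not necessarily induced) subgraphs which are pairwise vertex-disjoint and together contain every vertex of $G$ (so $|V(G)|=2s+3t$). Given real edge weights $w$ on $G$ and $k=|V(G)|$, a $k$-tuple $X=(x_1,\dots,x_k)$ of points of $\mathbb R^2$ is a distance $G$-configuration if there is a bijection $\varphi$ from $V(G)$ onto the set of points of $X$ such that $w(\{u,v\})=|\varphi(u)-\varphi(v)|$ for every edge $\{u,v\}$ of $G$; it is a dot product $G$-configuration if instead $w(\{u,v\})=\varphi(u)\cdot\varphi(v)$ for every edge. (In particular the points of $X$ are distinct.) Let $f(G;n)$, respectively $g(G;n)$, be the maximum, over all sets $E\subset\mathbb R^2$ of $n$ points, of the number of distance, respectively dot product, $G$-configurations consisting of points of $E$. Then there are constants $C$ and $N$, depending on $G$, $s$ and $t$ but not on $n$ or on the edge weights, such that for all $n>N$ $$f(G;n)\le C\,n^{\frac43 s+2t}\quad\text{for all real edge weights,}$$ $$g(G;n)\le C\,n^{\frac43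 s+2t}\quad\text{for all nonzero real edge weights.}$$ -/

import Mathlib

/-- The Euclidean plane. -/
abbrev Plane : Type := EuclideanSpace ℝ (Fin 2)

/-- Let `G` be a graph with edge weights `w`, and let `ρ` be a real quantity attached to pairs of
points of the plane. A `k`-tuple `X` of points, where `k` is the number of vertices of `G`, is a
`G`-configuration with respect to `ρ` if there is a bijection `φ` from the vertices of `G` onto the
points of `X` such that the weight of every edge `{u, v}` is `ρ (φ u) (φ v)`.
(Since `k` is the number of vertices, the points of such a tuple are automatically distinct.) -/
def IsConfiguration {V : Type*} [Fintype V] (ρ : Plane → Plane → ℝ) (G : SimpleGraph V)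
    (w : G.edgeSet → ℝ) (X : Fin (Fintype.card V) → Plane) : Prop :=
  ∃ φ : V → Plane, Set.BijOn φ Set.univ (Set.range X) ∧
    ∀ (u v : V) (h : G.Adj u v), w ⟨s(u, v), h⟩ = ρ (φ u) (φ v)

/-- Distance `G`-configurations. -/
def IsDistConfiguration {V : Type*} [Fintype V] (G : SimpleGraph V)
    (w : G.edgeSet → ℝ) (X : Fin (Fintype.card V) → Plane) : Prop :=
  IsConfiguration (fun x y => dist x y) G w X

/-- Dot product `G`-configurations. -/
def IsDotConfiguration {V : Type*} [Fintype V] (G : SimpleGraph V)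
    (w : G.edgeSet → ℝ) (X : Fin (Fintype.card V) → Plane) : Prop :=
  IsConfiguration (fun x y => inner ℝ x y) G w X

/-- The number of `k`-tuples of points of the finite set `E` that satisfy `P`. -/
noncomputable def tupleCount {k : ℕ} (P : (Fin k → Plane) → Prop) (E : Finset Plane) : ℕ :=
  Set.ncard {X : Fin k → Plane | (∀ i, X i ∈ E) ∧ P X}

/-- The maximum, over all sets `E` of `n` points of the plane, of the number of `k`-tuples of
points of `E` that satisfy `P`; see `isGreatest_maxTupleCount`. -/
noncomputable def maxTupleCount {k : ℕ} (P : (Fin k → Plane) → Prop) (n : ℕ) : ℕ :=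
  sSup {m : ℕ | ∃ E : Finset Plane, E.card = n ∧ tupleCount P E = m}

theorem tupleCount_le {k : ℕ} (P : (Fin k → Plane) → Prop) (E : Finset Plane) :
    tupleCount P E ≤ E.card ^ k := by
  classical
  have h : {X : Fin k → Plane | (∀ i, X i ∈ E) ∧ P X} ⊆
      ((Fintype.piFinset fun _ : Fin k => E : Finset (Fin k → Plane)) : Set (Fin k → Plane)) := by
    intro X hX
    simpa using hX.1
  have h2 := Set.ncard_le_ncard h (Finset.finite_toSet _)
  rw [Set.ncard_coe_finset, Fintype.card_piFinset] at h2
  simpa [tupleCount] using h2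

/-- The supremum in the definition of `maxTupleCount` is a genuine maximum. -/
theorem isGreatest_maxTupleCount {k : ℕ} (P : (Fin k → Plane) → Prop) (n : ℕ) :
    IsGreatest {m : ℕ | ∃ E : Finset Plane, E.card = n ∧ tupleCount P E = m}
      (maxTupleCount P n) := by
  have hb : BddAbove {m : ℕ | ∃ E : Finset Plane, E.card = n ∧ tupleCount P E = m} := by
    refine ⟨n ^ k, ?_⟩
    rintro m ⟨E, rfl, rfl⟩
    exact tupleCount_le P E
  have hne : {m : ℕ | ∃ E : Finset Plane, E.card = n ∧ tupleCount P E = m}.Nonempty := by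
    obtain ⟨E, hE⟩ := Infinite.exists_subset_card_eq Plane n
    exact ⟨_, E, hE, rfl⟩
  exact ⟨Nat.sSup_mem hne hb, fun m hm => le_csSup hb hm⟩

/-- `f(G; n)`: the maximum number of distance `G`-configurations in a set of `n` points of the
plane. -/
noncomputable def maxDistConfigurations {V : Type*} [Fintype V] (G : SimpleGraph V)
    (w : G.edgeSet → ℝ) (n : ℕ) : ℕ :=
  maxTupleCount (IsDistConfiguration G w) n

/-- `g(G; n)`: the maximum number of dot product `G`-configurations in a set of `n` points of the
plane. -/
noncomputable def maxDotConfigurations {V : Type*} [Fintype V] (G : SimpleGraph V)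
    (w : G.edgeSet → ℝ) (n : ℕ) : ℕ :=
  maxTupleCount (IsDotConfiguration G w) n

/-- `G` can be `(s, t)`-covered: there are `s` copies of the path `P₂` on two vertices and `t`
copies of the path `P₃` on three vertices in `G` (as subgraphs, not necessarily induced), all
pairwise vertex-disjoint (injectivity), which together contain every vertex (surjectivity). -/
def CanBeCovered {V : Type*} (G : SimpleGraph V) (s t : ℕ) : Prop :=
  ∃ (a : Fin s → SimpleGraph.Copy (SimpleGraph.pathGraph 2) G)
    (b : Fin t → SimpleGraph.Copy (SimpleGraph.pathGraph 3) G),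
    Function.Bijective
      (Sum.elim (fun p : Fin s × Fin 2 => a p.1 p.2) (fun q : Fin t × Fin 3 => b q.1 q.2))

/-!
The two bounds reduce to counting over the paths of the cover: a placement of the vertices is
determined by its restrictions to these paths, so the number of placements is at most a product
with one factor for each path, and each placement gives boundedly many tuples.

For a path on three vertices the factor is `2 * n ^ 2`. For distances, the middle point lies on two
circles with the two outer points as distinct centres, hence there are at most two choices for it
(`card_valueTriples_dist_le`). For nonzero dot products, either the outer points are linearly
independent and determine the middle one, or the first two points determine the third
(`card_valueTriples_inner_le`).

For a single edge the factor is `O(n ^ (4 / 3))`, by the Szemerédi–Trotter theorem for `n` points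
and `n` pseudo-segments (`IsPseudoSegments.card_incidences_le_rpow`), which covers both the upper
semicircles of a fixed radius and the lines `{y | x · y = c}` that are not vertical. It is proved by
Székely's method. Joining consecutive points on each curve by an arc gives a graph with at
most `n ^ 2` crossings. A crossing-free graph drawn by `x`-monotone arcs has at most three times as
many edges as vertices (`IsArcDrawing.card_le`); this is proved without Euler's formula, by charging
each arc either to its left end, if it is the topmost arc there, or else to a leftmost vertex in the
gap between it and the next arc above it. Deleting one arc of each crossing and passing to a random
subset of the points turns this into the crossing inequality.
-/

/-! ### Crossing-free drawings by monotone arcs -/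

open Set in
theorem le_on_Icc_of_lt_of_forall_ne {f g : ℝ → ℝ} {c d x z : ℝ}
    (hf : ContinuousOn f (Icc c d)) (hg : ContinuousOn g (Icc c d))
    (hne : ∀ y ∈ Ioo c d, f y ≠ g y) (hx : x ∈ Icc c d) (hlt : f x < g x) (hz : z ∈ Icc c d) :
    f z ≤ g z := by
  by_contra! hcon
  have hsub : uIcc x z ⊆ Icc c d := ordConnected_Icc.uIcc_subset hx hz
  have hcont : ContinuousOn (fun y => g y - f y) (uIcc x z) := (hg.sub hf).mono hsub
  have h0 : (0 : ℝ) ∈ uIcc (g x - f x) (g z - f z) := by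
    rw [mem_uIcc]; right; constructor <;> linarith
  obtain ⟨y, hy, hy0⟩ := intermediate_value_uIcc hcont h0
  simp only at hy0
  have hyx : y ≠ x := by rintro rfl; linarith
  have hyz : y ≠ z := by rintro rfl; linarith
  refine hne y ?_ (by linarith)
  rcases mem_uIcc.1 hy with h | h
  · exact ⟨hx.1.trans_lt (lt_of_le_of_ne h.1 hyx.symm), (lt_of_le_of_ne h.2 hyz).trans_le hz.2⟩
  · exact ⟨hz.1.trans_lt (lt_of_le_of_ne h.1 hyz.symm), (lt_of_le_of_ne h.2 hyx).trans_le hx.2⟩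

open Set in
/-- A crossing-free drawing of a simple graph by `x`-monotone arcs: the vertices are the points
of `P`, and the edge `i ∈ E` is the graph of `f i` over `[a i, b i]`. Arcs pass through no vertex
except their ends, their interiors are disjoint, and no two of them have the same two ends. -/
structure IsArcDrawing {ι : Type*} (P : Finset (ℝ × ℝ)) (E : Finset ι) (f : ι → ℝ → ℝ)
    (a b : ι → ℝ) : Prop where
  lt : ∀ i ∈ E, a i < b i
  cont : ∀ i ∈ E, ContinuousOn (f i) (Icc (a i) (b i))
  left_mem : ∀ i ∈ E, (a i, f i (a i)) ∈ P
  right_mem : ∀ i ∈ E, (b i, f i (b i)) ∈ P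
  notMem : ∀ i ∈ E, ∀ x ∈ Ioo (a i) (b i), (x, f i x) ∉ P
  ne_of_mem : ∀ i ∈ E, ∀ j ∈ E, i ≠ j → ∀ x ∈ Ioo (a i) (b i), x ∈ Ioo (a j) (b j) → f i x ≠ f j x
  simple : ∀ i ∈ E, ∀ j ∈ E, a i = a j → f i (a i) = f j (a j) → b i = b j →
    f i (b i) = f j (b j) → i = j

/-- The arcs `i` and `j` leave the same vertex, `j` just above `i` (the order of the arcs that
leave this vertex is read off at the abscissa `x₀`), and `v` is a leftmost vertex in the gap
between them, chosen to be the right end of `i` if that is possible. -/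
structure IsArcGap {ι : Type*} (P : Finset (ℝ × ℝ)) (E : Finset ι) (f : ι → ℝ → ℝ)
    (a b : ι → ℝ) (i j : ι) (x₀ : ℝ) (v : ℝ × ℝ) : Prop where
  mem_i : i ∈ E
  mem_j : j ∈ E
  left_eq : a j = a i
  left_val : f j (a i) = f i (a i)
  lt_x₀ : a i < x₀
  x₀_lt : x₀ < v.1
  lt_val : f i x₀ < f j x₀
  next : ∀ k ∈ E, a k = a i → f k (a i) = f i (a i) → f i x₀ < f k x₀ → f k x₀ < f j x₀ → False
  mem_v : v ∈ P
  le_i : v.1 ≤ b i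
  le_j : v.1 ≤ b j
  i_le : f i v.1 ≤ v.2
  le_val_j : v.2 ≤ f j v.1
  leftmost : ∀ p ∈ P, a i < p.1 → p.1 < v.1 → f i p.1 ≤ p.2 → p.2 ≤ f j p.1 → False
  right_eq : b i = v.1 → f i v.1 = v.2

section
open Set Filter Topology

variable {ι : Type*} {P : Finset (ℝ × ℝ)} {E : Finset ι} {f : ι → ℝ → ℝ} {a b : ι → ℝ}
  {i j k : ι} {x₀ x z : ℝ} {v : ℝ × ℝ}

theorem IsArcDrawing.ne (h : IsArcDrawing P E f a b) (hi : i ∈ E) (hj : j ∈ E) (hij : i ≠ j)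
    (hx : x ∈ Ioo (a i) (b i)) (hx' : x ∈ Icc (a j) (b j)) : f i x ≠ f j x := by
  intro heq
  rcases eq_or_lt_of_le hx'.1 with h1 | h1
  · exact h.notMem i hi x hx (by rw [heq, ← h1]; exact h.left_mem j hj)
  rcases eq_or_lt_of_le hx'.2 with h2 | h2
  · exact h.notMem i hi x hx (by rw [heq, h2]; exact h.right_mem j hj)
  exact h.ne_of_mem i hi j hj hij x hx ⟨h1, h2⟩ heq

theorem IsArcDrawing.le_of_lt (h : IsArcDrawing P E f a b) (hi : i ∈ E) (hj : j ∈ E)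
    (hxi : x ∈ Icc (a i) (b i)) (hxj : x ∈ Icc (a j) (b j)) (hlt : f i x < f j x)
    (hzi : z ∈ Icc (a i) (b i)) (hzj : z ∈ Icc (a j) (b j)) : f i z ≤ f j z := by
  have hij : i ≠ j := by rintro rfl; exact lt_irrefl _ hlt
  refine le_on_Icc_of_lt_of_forall_ne (c := max (a i) (a j)) (d := min (b i) (b j)) (x := x)
    ((h.cont i hi).mono ?_) ((h.cont j hj).mono ?_) ?_ ?_ hlt ?_
  · exact Icc_subset_Icc (le_max_left _ _) (min_le_left _ _)
  · exact Icc_subset_Icc (le_max_right _ _) (min_le_right _ _)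
  · intro y hy
    rw [mem_Ioo, max_lt_iff, lt_min_iff] at hy
    exact h.ne_of_mem i hi j hj hij y ⟨hy.1.1, hy.2.1⟩ ⟨hy.1.2, hy.2.2⟩
  · exact ⟨max_le hxi.1 hxj.1, le_min hxi.2 hxj.2⟩
  · exact ⟨max_le hzi.1 hzj.1, le_min hzi.2 hzj.2⟩

/-- To the left of `v`, no arc runs inside the gap: followed to the left, it would have to begin
at a vertex inside the gap, or to be an arc between `i` and `j` from their common left end. -/
theorem IsArcGap.not_between (h : IsArcDrawing P E f a b) (g : IsArcGap P E f a b i j x₀ v)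
    (hk : k ∈ E) (hx₀ : x₀ < x) (hxv : x ≤ v.1) (hak : a k < x) (hbk : x ≤ b k)
    (hik : f i x < f k x) (hkj : f k x < f j x) : False := by
  obtain ⟨hi, hj, hl, hlv, h1, h2, h3, hnext, hv, hvi, hvj, h4, h5, hmin, -⟩ := g
  have hne1 : i ≠ k := by rintro rfl; exact lt_irrefl _ hik
  have hne2 : j ≠ k := by rintro rfl; exact lt_irrefl _ hkj
  have key : ∀ z, a i ≤ z → a k ≤ z → z ≤ x → f i z ≤ f k z ∧ f k z ≤ f j z := by
    intro z hz1 hz2 hz3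
    constructor
    · exact h.le_of_lt hi hk (x := x) ⟨by linarith, by linarith⟩ ⟨hak.le, hbk⟩ hik
        ⟨hz1, by linarith⟩ ⟨hz2, by linarith⟩
    · exact h.le_of_lt hk hj (x := x) ⟨hak.le, hbk⟩ ⟨by linarith, by linarith⟩ hkj
        ⟨hz2, by linarith⟩ ⟨by linarith, by linarith⟩
  rcases lt_trichotomy (a i) (a k) with hlt | heq | hgt
  · obtain ⟨h6, h7⟩ := key (a k) hlt.le le_rfl hak.le
    exact hmin _ (h.left_mem k hk) hlt (by simp only; linarith) h6 h7
  · obtain ⟨h6, h7⟩ := key (a i) le_rfl heq.ge (by linarith)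
    obtain ⟨h8, h9⟩ := key x₀ h1.le (by linarith) hx₀.le
    refine hnext k hk heq.symm (by linarith) (lt_of_le_of_ne h8 ?_) (lt_of_le_of_ne h9 ?_)
    · exact h.ne hi hk hne1 ⟨h1, by linarith⟩ ⟨by linarith, by linarith⟩
    · exact (h.ne hj hk hne2 ⟨by linarith, by linarith⟩ ⟨by linarith, by linarith⟩).symm
  · obtain ⟨h6, h7⟩ := key (a i) le_rfl hgt.le (by linarith)
    have h8 : f k (a i) = f i (a i) := by linarith
    exact h.notMem k hk (a i) ⟨hgt, by linarith⟩ (by rw [h8]; exact h.left_mem i hi)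

/-- At most one gap below which the arc ends in `v` belongs to `v`. -/
theorem IsArcGap.eq_of_right_eq (h : IsArcDrawing P E f a b) {i' j' : ι} {x₀' : ℝ}
    (g : IsArcGap P E f a b i j x₀ v) (g' : IsArcGap P E f a b i' j' x₀' v)
    (hb : b i = v.1) (hb' : b i' = v.1) : i = i' := by
  have strict : ∀ {i j : ι} {x₀ : ℝ}, IsArcGap P E f a b i j x₀ v → b i = v.1 → v.2 < f j v.1 := by
    intro i j x₀ g hb
    refine lt_of_le_of_ne g.le_val_j fun heq => ?_
    have hav : a j < v.1 := by rw [g.left_eq]; exact g.lt_x₀.trans g.x₀_lt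
    have hbj : b j = v.1 := by
      by_contra hne
      exact h.notMem j g.mem_j v.1 ⟨hav, lt_of_le_of_ne g.le_j (Ne.symm hne)⟩
        (by rw [← heq]; exact g.mem_v)
    have := h.simple i g.mem_i j g.mem_j g.left_eq.symm (by rw [g.left_eq, g.left_val])
      (hb.trans hbj.symm) (by rw [hb, hbj, g.right_eq hb, heq])
    subst this
    exact lt_irrefl _ g.lt_val
  have near : ∀ {i j i' j' : ι} {x₀ x₀' : ℝ}, IsArcGap P E f a b i j x₀ v →
      IsArcGap P E f a b i' j' x₀' v → b i = v.1 → b i' = v.1 →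
      ∀ᶠ x in 𝓝[<] v.1, f i' x < f j x := by
    intro i j i' j' x₀ x₀' g g' hb hb'
    have c1 : ContinuousWithinAt (f i') (Ioo (a i') v.1) v.1 :=
      ((h.cont i' g'.mem_i) v.1 ⟨(g'.lt_x₀.trans g'.x₀_lt).le, hb'.ge⟩).mono
        (Ioo_subset_Icc_self.trans (Icc_subset_Icc le_rfl hb'.ge))
    have c2 : ContinuousWithinAt (f j) (Ioo (a i) v.1) v.1 :=
      ((h.cont j g.mem_j) v.1 ⟨g.left_eq.le.trans (g.lt_x₀.trans g.x₀_lt).le, g.le_j⟩).mono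
        (Ioo_subset_Icc_self.trans (Icc_subset_Icc g.left_eq.le g.le_j))
    rw [ContinuousWithinAt, nhdsWithin_Ioo_eq_nhdsLT (g'.lt_x₀.trans g'.x₀_lt)] at c1
    rw [ContinuousWithinAt, nhdsWithin_Ioo_eq_nhdsLT (g.lt_x₀.trans g.x₀_lt)] at c2
    exact c1.eventually_lt c2 (by rw [g'.right_eq hb']; exact strict g hb)
  by_contra hne
  have e0 : ∀ᶠ x in 𝓝[<] v.1, x ∈ Ioo (max x₀ x₀') v.1 :=
    Ioo_mem_nhdsLT (max_lt g.x₀_lt g'.x₀_lt)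
  obtain ⟨x, hx1, hx2, hx⟩ := (((near g g' hb hb').and ((near g' g hb' hb).and e0))).exists
  rw [mem_Ioo, max_lt_iff] at hx
  obtain ⟨⟨h3, h4⟩, h5⟩ := hx
  have h6 := g.lt_x₀
  have h7 := g'.lt_x₀
  rcases lt_or_gt_of_ne (h.ne_of_mem i g.mem_i i' g'.mem_i hne x ⟨by linarith, by linarith⟩
    ⟨by linarith, by linarith⟩) with hlt | hlt
  · exact g.not_between h g'.mem_i h3 h5.le (by linarith) (by linarith) hlt hx1
  · exact g'.not_between h g.mem_i h4 h5.le (by linarith) (by linarith) hlt hx2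

/-- At most one gap below which the arc passes strictly below `v` belongs to `v`. -/
theorem IsArcGap.eq_of_right_ne (h : IsArcDrawing P E f a b) {i' j' : ι} {x₀' : ℝ}
    (g : IsArcGap P E f a b i j x₀ v) (g' : IsArcGap P E f a b i' j' x₀' v)
    (hb : b i ≠ v.1) (hb' : b i' ≠ v.1) : i = i' := by
  have int : ∀ {i j : ι} {x₀ : ℝ}, IsArcGap P E f a b i j x₀ v → b i ≠ v.1 →
      v.1 ∈ Ioo (a i) (b i) ∧ f i v.1 < v.2 := by
    intro i j x₀ g hb
    have hm : v.1 ∈ Ioo (a i) (b i) :=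
      ⟨g.lt_x₀.trans g.x₀_lt, lt_of_le_of_ne g.le_i hb.symm⟩
    refine ⟨hm, lt_of_le_of_ne g.i_le fun heq => h.notMem i g.mem_i _ hm ?_⟩
    rw [heq]; exact g.mem_v
  obtain ⟨hm, hlt⟩ := int g hb
  obtain ⟨hm', hlt'⟩ := int g' hb'
  by_contra hne
  rcases lt_or_gt_of_ne (h.ne_of_mem i g.mem_i i' g'.mem_i hne v.1 hm hm') with h1 | h1
  · exact g.not_between h g'.mem_i g.x₀_lt le_rfl hm'.1 hm'.2.le h1 (hlt'.trans_le g.le_val_j)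
  · exact g'.not_between h g.mem_i g'.x₀_lt le_rfl hm.1 hm.2.le h1 (hlt.trans_le g'.le_val_j)

/-- Just to the right of `a` there is an abscissa that precedes all later points of `P`: there the
arcs that leave the points above `a` can be compared. -/
theorem exists_gt_forall_lt (P : Finset (ℝ × ℝ)) (a : ℝ) :
    ∃ x₀, a < x₀ ∧ ∀ p ∈ P, a < p.1 → x₀ < p.1 := by
  have h1 : ∀ᶠ x in 𝓝[>] a, ∀ p ∈ P, a < p.1 → x < p.1 := by
    rw [Finset.eventually_all]
    intro p _
    by_cases hp : a < p.1
    · filter_upwards [Ioo_mem_nhdsGT hp] with x hx _ using hx.2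
    · exact Eventually.of_forall fun x h => absurd h hp
  obtain ⟨x, hx, hx'⟩ := (h1.and self_mem_nhdsWithin).exists
  exact ⟨x, hx', hx⟩

/-- An arc that is not the topmost one at its left end lies just below a gap. -/
theorem IsArcDrawing.exists_gap (h : IsArcDrawing P E f a b) (hi : i ∈ E)
    (hx₀ : a i < x₀) (hx₀P : ∀ p ∈ P, a i < p.1 → x₀ < p.1)
    (hk : ∃ k ∈ E, a k = a i ∧ f k (a i) = f i (a i) ∧ f i x₀ < f k x₀) :
    ∃ j v, IsArcGap P E f a b i j x₀ v := by
  classical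
  obtain ⟨j, hj, hjmin⟩ := Finset.exists_min_image
    (E.filter fun k => a k = a i ∧ f k (a i) = f i (a i) ∧ f i x₀ < f k x₀) (fun k => f k x₀) (by
      obtain ⟨k, hk, h'⟩ := hk
      exact ⟨k, Finset.mem_filter.2 ⟨hk, h'⟩⟩)
  obtain ⟨hjE, hja, hjv, hjlt⟩ := Finset.mem_filter.1 hj
  have hbi := h.lt i hi
  have hbj := h.lt j hjE
  have hxi : x₀ < b i := hx₀P _ (h.right_mem i hi) hbi
  have hxj : x₀ < b j := hx₀P _ (h.right_mem j hjE) (by simp only; linarith)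
  have hle : ∀ z, a i ≤ z → z ≤ b i → z ≤ b j → f i z ≤ f j z := fun z h1 h2 h3 =>
    h.le_of_lt hi hjE (x := x₀) ⟨hx₀.le, hxi.le⟩ ⟨by linarith, hxj.le⟩ hjlt ⟨h1, h2⟩
      ⟨by linarith, h3⟩
  -- Lexicographic order: among the leftmost vertices in the gap, `v` is the lowest.
  obtain ⟨v, hv, hvmin⟩ := Finset.exists_min_image
    (P.filter fun p => a i < p.1 ∧ p.1 ≤ b i ∧ p.1 ≤ b j ∧ f i p.1 ≤ p.2 ∧ p.2 ≤ f j p.1)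
    (fun p => toLex p) (by
      rcases le_total (b i) (b j) with hb | hb
      · exact ⟨_, Finset.mem_filter.2 ⟨h.right_mem i hi, hbi, le_rfl, hb, le_rfl,
          hle _ hbi.le le_rfl hb⟩⟩
      · exact ⟨_, Finset.mem_filter.2 ⟨h.right_mem j hjE, by simp only; linarith, hb, le_rfl,
          hle _ (by linarith) hb le_rfl, le_rfl⟩⟩)
  obtain ⟨hvP, hv1, hv2, hv3, hv4, hv5⟩ := Finset.mem_filter.1 hv
  have hvmin' : ∀ p ∈ P, a i < p.1 → p.1 ≤ b i → p.1 ≤ b j → f i p.1 ≤ p.2 → p.2 ≤ f j p.1 →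
      v.1 < p.1 ∨ v.1 = p.1 ∧ v.2 ≤ p.2 := by
    intro p h1 h2 h3 h4 h5 h6
    exact Prod.Lex.toLex_le_toLex.1 (hvmin p (Finset.mem_filter.2 ⟨h1, h2, h3, h4, h5, h6⟩))
  refine ⟨j, v, hi, hjE, hja, hjv, hx₀, hx₀P v hvP hv1, hjlt, ?_, hvP, hv2, hv3, hv4, hv5, ?_, ?_⟩
  · intro k hk h1 h2 h3 h4
    exact (hjmin k (Finset.mem_filter.2 ⟨hk, h1, h2, h3⟩)).not_gt h4
  · intro p h1 h2 h3 h4 h5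
    rcases hvmin' p h1 h2 (by linarith) (by linarith) h4 h5 with h6 | h6
    · linarith
    · linarith [h6.1]
  · intro hb
    rcases hvmin' (v.1, f i v.1) (by rw [← hb]; exact h.right_mem i hi) hv1 hv2 hv3 le_rfl
      (hv4.trans hv5) with h6 | h6
    · exact absurd h6 (lt_irrefl _)
    · exact le_antisymm hv4 h6.2

/-- A linear bound on the number of edges of a graph drawn without crossings by `x`-monotone
arcs. -/
theorem IsArcDrawing.card_le (h : IsArcDrawing P E f a b) : E.card ≤ 3 * P.card := by
  classical
  choose x₀ hx₀ hx₀P using exists_gt_forall_lt P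
  -- The topmost arcs at their left ends; then those below a gap whose vertex is, or is not, their
  -- right end.
  let T : Finset ι := E.filter fun i => ¬ ∃ k ∈ E, a k = a i ∧ f k (a i) = f i (a i) ∧
    f i (x₀ (a i)) < f k (x₀ (a i))
  let T₁ : Finset ι := E.filter fun i => ∃ j v, IsArcGap P E f a b i j (x₀ (a i)) v ∧ b i = v.1
  let T₂ : Finset ι := E.filter fun i => ∃ j v, IsArcGap P E f a b i j (x₀ (a i)) v ∧ b i ≠ v.1
  have hsub : E ⊆ T ∪ T₁ ∪ T₂ := by
    intro i hi
    simp only [T, T₁, T₂, Finset.mem_union, Finset.mem_filter, hi, true_and]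
    by_cases hk : ∃ k ∈ E, a k = a i ∧ f k (a i) = f i (a i) ∧ f i (x₀ (a i)) < f k (x₀ (a i))
    · obtain ⟨j, v, g⟩ := h.exists_gap hi (hx₀ _) (hx₀P _) hk
      by_cases hb : b i = v.1
      · exact Or.inl (Or.inr ⟨j, v, g, hb⟩)
      · exact Or.inr ⟨j, v, g, hb⟩
    · exact Or.inl (Or.inl hk)
  have hT : T.card ≤ P.card := by
    refine Finset.card_le_card_of_injOn (fun i => (a i, f i (a i)))
      (fun i hi => h.left_mem i (Finset.mem_filter.1 hi).1) ?_
    intro i hi i' hi' heq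
    obtain ⟨hiE, hi⟩ := Finset.mem_filter.1 hi
    obtain ⟨hiE', hi'⟩ := Finset.mem_filter.1 hi'
    obtain ⟨h1, h2⟩ := Prod.mk.inj heq
    by_contra hne
    have m : ∀ k ∈ E, a k = a i → x₀ (a i) ∈ Ioo (a k) (b k) := fun k hk hak =>
      ⟨hak ▸ hx₀ _, hx₀P _ _ (h.right_mem k hk) (hak ▸ h.lt k hk)⟩
    rcases lt_or_gt_of_ne (h.ne_of_mem i hiE i' hiE' hne _ (m i hiE rfl) (m i' hiE' h1.symm))
      with h3 | h3
    · exact hi ⟨i', hiE', h1.symm, by rw [h2, h1], h3⟩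
    · exact hi' ⟨i, hiE, h1, by rw [← h2, h1], by rw [← h1]; exact h3⟩
  have hT₁ : T₁.card ≤ P.card := by
    have : ∀ i ∈ T₁, ∃ v ∈ P, ∃ j, IsArcGap P E f a b i j (x₀ (a i)) v ∧ b i = v.1 := by
      intro i hi
      obtain ⟨-, j, v, g, hb⟩ := Finset.mem_filter.1 hi
      exact ⟨v, g.mem_v, j, g, hb⟩
    choose! v hvP j g hb using this
    refine Finset.card_le_card_of_injOn v hvP fun i hi i' hi' heq => ?_
    exact (g i hi).eq_of_right_eq h (heq ▸ g i' hi') (hb i hi) (heq ▸ hb i' hi')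
  have hT₂ : T₂.card ≤ P.card := by
    have : ∀ i ∈ T₂, ∃ v ∈ P, ∃ j, IsArcGap P E f a b i j (x₀ (a i)) v ∧ b i ≠ v.1 := by
      intro i hi
      obtain ⟨-, j, v, g, hb⟩ := Finset.mem_filter.1 hi
      exact ⟨v, g.mem_v, j, g, hb⟩
    choose! v hvP j g hb using this
    refine Finset.card_le_card_of_injOn v hvP fun i hi i' hi' heq => ?_
    exact (g i hi).eq_of_right_ne h (heq ▸ g i' hi') (hb i hi) (heq ▸ hb i' hi')
  have h1 := Finset.card_le_card hsub
  have h2 := Finset.card_union_le (T ∪ T₁) T₂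
  have h3 := Finset.card_union_le T T₁
  omega

end

/-! ### Crossings among arcs of pseudo-segments -/

section
open Set

/-- A family of pseudo-segments: graphs of continuous functions over intervals, any two of which
have at most one point in common. -/
structure IsPseudoSegments {α : Type*} (L : Finset α) (D : α → Set ℝ) (f : α → ℝ → ℝ) : Prop where
  ordConnected : ∀ l ∈ L, (D l).OrdConnected
  cont : ∀ l ∈ L, ContinuousOn (f l) (D l)
  inter : ∀ l ∈ L, ∀ l' ∈ L, l ≠ l' → ∀ x ∈ D l, x ∈ D l' → ∀ y ∈ D l, y ∈ D l' →
    f l x = f l' x → f l y = f l' y → x = y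

open Classical in
/-- The incidences between the points of `P` and the graphs of `f l` over `D l`, for `l ∈ L`. -/
noncomputable def incidences {α : Type*} (P : Finset (ℝ × ℝ)) (L : Finset α) (D : α → Set ℝ)
    (f : α → ℝ → ℝ) : Finset ((ℝ × ℝ) × α) :=
  (P ×ˢ L).filter fun q => q.1.1 ∈ D q.2 ∧ f q.2 q.1.1 = q.1.2

open Classical in
/-- The triples `(l, p, q)` where `p` and `q` are consecutive points of `P`, from left to right,
on the curve `l`. -/
noncomputable def consecutive {α : Type*} (P : Finset (ℝ × ℝ)) (L : Finset α) (D : α → Set ℝ)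
    (f : α → ℝ → ℝ) : Finset (α × (ℝ × ℝ) × (ℝ × ℝ)) :=
  (L ×ˢ P ×ˢ P).filter fun e => (e.2.1, e.1) ∈ incidences P L D f ∧
    (e.2.2, e.1) ∈ incidences P L D f ∧ e.2.1.1 < e.2.2.1 ∧
    ∀ r, (r, e.1) ∈ incidences P L D f → e.2.1.1 < r.1 → r.1 < e.2.2.1 → False

open Classical in
/-- The ordered pairs of arcs, on two distinct curves, whose interiors meet. -/
noncomputable def crossings {α : Type*} (P : Finset (ℝ × ℝ)) (L : Finset α) (D : α → Set ℝ)
    (f : α → ℝ → ℝ) : Finset ((α × (ℝ × ℝ) × (ℝ × ℝ)) × (α × (ℝ × ℝ) × (ℝ × ℝ))) :=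
  (consecutive P L D f ×ˢ consecutive P L D f).filter fun c => c.1.1 ≠ c.2.1 ∧
    ∃ x ∈ Ioo c.1.2.1.1 c.1.2.2.1, x ∈ Ioo c.2.2.1.1 c.2.2.2.1 ∧ f c.1.1 x = f c.2.1 x

variable {α : Type*} {P S : Finset (ℝ × ℝ)} {L : Finset α} {D : α → Set ℝ} {f : α → ℝ → ℝ}

theorem mem_incidences {p : ℝ × ℝ} {l : α} :
    (p, l) ∈ incidences P L D f ↔ p ∈ P ∧ l ∈ L ∧ p.1 ∈ D l ∧ f l p.1 = p.2 := by
  simp [incidences, and_assoc]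

theorem mem_consecutive {l : α} {p q : ℝ × ℝ} :
    (l, p, q) ∈ consecutive P L D f ↔ (p, l) ∈ incidences P L D f ∧
      (q, l) ∈ incidences P L D f ∧ p.1 < q.1 ∧
      ∀ r, (r, l) ∈ incidences P L D f → p.1 < r.1 → r.1 < q.1 → False := by
  simp only [consecutive, Finset.mem_filter, Finset.mem_product, and_iff_right_iff_imp]
  rintro ⟨h1, h2, -⟩
  rw [mem_incidences] at h1 h2
  exact ⟨h1.2.1, h1.1, h2.1⟩

theorem mem_crossings {c : (α × (ℝ × ℝ) × (ℝ × ℝ)) × (α × (ℝ × ℝ) × (ℝ × ℝ))} :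
    c ∈ crossings P L D f ↔ (c.1 ∈ consecutive P L D f ∧ c.2 ∈ consecutive P L D f) ∧
    c.1.1 ≠ c.2.1 ∧
    ∃ x ∈ Ioo c.1.2.1.1 c.1.2.2.1, x ∈ Ioo c.2.2.1.1 c.2.2.2.1 ∧ f c.1.1 x = f c.2.1 x := by
  simp [crossings]

theorem eq_of_mem_incidences {l : α} {p q : ℝ × ℝ} (hp : (p, l) ∈ incidences P L D f)
    (hq : (q, l) ∈ incidences P L D f) (h : p.1 = q.1) : p = q := by
  rw [mem_incidences] at hp hq
  exact Prod.ext h (by rw [← hp.2.2.2, ← hq.2.2.2, h])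

theorem eq_of_mem_consecutive {l : α} {p q p' q' : ℝ × ℝ} {x : ℝ}
    (h : (l, p, q) ∈ consecutive P L D f) (h' : (l, p', q') ∈ consecutive P L D f)
    (hx : x ∈ Ioo p.1 q.1) (hx' : x ∈ Ioo p'.1 q'.1) : p = p' ∧ q = q' := by
  obtain ⟨hp, hq, -, hc⟩ := mem_consecutive.1 h
  obtain ⟨hp', hq', -, hc'⟩ := mem_consecutive.1 h'
  constructor
  · refine eq_of_mem_incidences hp hp' (le_antisymm ?_ ?_) <;> by_contra! hlt
    · exact hc' _ hp hlt (hx.1.trans hx'.2)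
    · exact hc _ hp' hlt (hx'.1.trans hx.2)
  · refine eq_of_mem_incidences hq hq' (le_antisymm ?_ ?_) <;> by_contra! hlt
    · exact hc _ hq' (hx.1.trans hx'.2) hlt
    · exact hc' _ hq (hx'.1.trans hx.2) hlt

theorem IsPseudoSegments.mem_of_mem_consecutive (h : IsPseudoSegments L D f) {l : α}
    {p q : ℝ × ℝ} {x : ℝ} (hc : (l, p, q) ∈ consecutive P L D f) (hx : x ∈ Icc p.1 q.1) :
    x ∈ D l := by
  obtain ⟨hp, hq, -, -⟩ := mem_consecutive.1 hc
  rw [mem_incidences] at hp hq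
  exact (h.ordConnected l hp.2.1).out hp.2.2.1 hq.2.2.1 hx

/-- Every incidence is either the leftmost one on its curve or the right end of an arc. -/
theorem card_incidences_le (P : Finset (ℝ × ℝ)) (L : Finset α) (D : α → Set ℝ)
    (f : α → ℝ → ℝ) :
    (incidences P L D f).card ≤ (consecutive P L D f).card + L.card := by
  classical
  let A := (incidences P L D f).filter fun q => ∀ r, (r, q.2) ∈ incidences P L D f → q.1.1 ≤ r.1
  have hA : A.card ≤ L.card := by
    refine Finset.card_le_card_of_injOn Prod.snd ?_ ?_
    · intro q hq
      exact (mem_incidences.1 (Finset.mem_filter.1 hq).1).2.1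
    · rintro ⟨p, l⟩ hp ⟨q, l'⟩ hq heq
      obtain rfl : l = l' := heq
      obtain ⟨h1, h2⟩ := Finset.mem_filter.1 hp
      obtain ⟨h3, h4⟩ := Finset.mem_filter.1 hq
      rw [eq_of_mem_incidences h1 h3 (le_antisymm (h2 q h3) (h4 p h1))]
  have hsub : incidences P L D f ⊆ (consecutive P L D f).image (fun e => (e.2.2, e.1)) ∪ A := by
    rintro ⟨q, l⟩ hq
    rw [Finset.mem_union]
    by_cases hmin : ∀ r, (r, l) ∈ incidences P L D f → q.1 ≤ r.1
    · exact Or.inr (Finset.mem_filter.2 ⟨hq, hmin⟩)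
    push Not at hmin
    obtain ⟨r, hr, hrq⟩ := hmin
    obtain ⟨p, hp, hmax⟩ := Finset.exists_max_image
      (P.filter fun p => (p, l) ∈ incidences P L D f ∧ p.1 < q.1) (fun p => p.1)
      ⟨r, Finset.mem_filter.2 ⟨(mem_incidences.1 hr).1, hr, hrq⟩⟩
    obtain ⟨-, hpl, hpq⟩ := Finset.mem_filter.1 hp
    refine Or.inl (Finset.mem_image.2 ⟨(l, p, q), mem_consecutive.2 ⟨hpl, hq, hpq, ?_⟩, rfl⟩)
    intro s hs h1 h2
    exact (hmax s (Finset.mem_filter.2 ⟨(mem_incidences.1 hs).1, hs, h2⟩)).not_gt h1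
  calc (incidences P L D f).card ≤ _ := Finset.card_le_card hsub
    _ ≤ _ := Finset.card_union_le _ _
    _ ≤ _ := Nat.add_le_add Finset.card_image_le hA

open Classical in
/-- Deleting one arc of each crossing among the arcs with both ends in `S` leaves a crossing-free
drawing with vertex set `S`. -/
theorem IsPseudoSegments.card_filter_consecutive_le (h : IsPseudoSegments L D f) (hS : S ⊆ P) :
    ((consecutive P L D f).filter fun e => ({e.2.1, e.2.2} : Finset (ℝ × ℝ)) ⊆ S).card ≤
      3 * S.card + ((crossings P L D f).filter fun c =>
        ({c.1.2.1, c.1.2.2, c.2.2.1, c.2.2.2} : Finset (ℝ × ℝ)) ⊆ S).card := by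
  set A := (consecutive P L D f).filter fun e => ({e.2.1, e.2.2} : Finset (ℝ × ℝ)) ⊆ S with hA
  set X := (crossings P L D f).filter fun c =>
    ({c.1.2.1, c.1.2.2, c.2.2.1, c.2.2.2} : Finset (ℝ × ℝ)) ⊆ S with hX
  have memA : ∀ l p q, (l, p, q) ∈ A ↔ (l, p, q) ∈ consecutive P L D f ∧ p ∈ S ∧ q ∈ S := by
    intro l p q
    simp [hA, Finset.insert_subset_iff]
  have hdraw : IsArcDrawing S (A \ X.image Prod.fst) (fun e => f e.1) (fun e => e.2.1.1)
      (fun e => e.2.2.1) := by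
    constructor
    · rintro ⟨l, p, q⟩ he
      exact (mem_consecutive.1 ((memA _ _ _).1 (Finset.mem_sdiff.1 he).1).1).2.2.1
    · rintro ⟨l, p, q⟩ he
      have he := ((memA _ _ _).1 (Finset.mem_sdiff.1 he).1).1
      have hl := (mem_incidences.1 (mem_consecutive.1 he).1).2.1
      exact (h.cont l hl).mono fun x hx => h.mem_of_mem_consecutive he hx
    · rintro ⟨l, p, q⟩ he
      obtain ⟨he, hp, hq⟩ := (memA _ _ _).1 (Finset.mem_sdiff.1 he).1
      simp only
      rwa [(mem_incidences.1 (mem_consecutive.1 he).1).2.2.2]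
    · rintro ⟨l, p, q⟩ he
      obtain ⟨he, hp, hq⟩ := (memA _ _ _).1 (Finset.mem_sdiff.1 he).1
      simp only
      rwa [(mem_incidences.1 (mem_consecutive.1 he).2.1).2.2.2]
    · rintro ⟨l, p, q⟩ he x hx hxS
      obtain ⟨he, hp, hq⟩ := (memA _ _ _).1 (Finset.mem_sdiff.1 he).1
      refine (mem_consecutive.1 he).2.2.2 (x, f l x) ?_ hx.1 hx.2
      exact mem_incidences.2 ⟨hS hxS, (mem_incidences.1 (mem_consecutive.1 he).1).2.1,
        h.mem_of_mem_consecutive he ⟨hx.1.le, hx.2.le⟩, rfl⟩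
    · rintro ⟨l, p, q⟩ he ⟨l', p', q'⟩ he' hne x hx hx' heq
      obtain ⟨he, hn⟩ := Finset.mem_sdiff.1 he
      obtain ⟨he, hp, hq⟩ := (memA _ _ _).1 he
      obtain ⟨he', hp', hq'⟩ := (memA _ _ _).1 (Finset.mem_sdiff.1 he').1
      by_cases hl : l = l'
      · subst hl
        obtain ⟨rfl, rfl⟩ := eq_of_mem_consecutive he he' hx hx'
        exact hne rfl
      · refine hn (Finset.mem_image.2 ⟨((l, p, q), (l', p', q')), ?_, rfl⟩)
        rw [hX, Finset.mem_filter, mem_crossings]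
        refine ⟨⟨⟨he, he'⟩, hl, x, hx, hx', heq⟩, ?_⟩
        simp [Finset.insert_subset_iff, hp, hq, hp', hq']
    · rintro ⟨l, p, q⟩ he ⟨l', p', q'⟩ he' h1 h2 h3 h4
      simp only at h1 h2 h3 h4
      obtain ⟨he, -, -⟩ := (memA _ _ _).1 (Finset.mem_sdiff.1 he).1
      obtain ⟨he', -, -⟩ := (memA _ _ _).1 (Finset.mem_sdiff.1 he').1
      obtain ⟨hp, hq, hlt, -⟩ := mem_consecutive.1 he
      obtain ⟨hp', hq', -, -⟩ := mem_consecutive.1 he'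
      have ip := mem_incidences.1 hp
      have iq := mem_incidences.1 hq
      have ip' := mem_incidences.1 hp'
      have iq' := mem_incidences.1 hq'
      by_cases hl : l = l'
      · subst hl
        rw [eq_of_mem_incidences hp hp' h1, eq_of_mem_incidences hq hq' h3]
      · exfalso
        refine hlt.ne (h.inter l ip.2.1 l' ip'.2.1 hl _ ip.2.2.1 (h1 ▸ ip'.2.2.1) _ iq.2.2.1
          (h3 ▸ iq'.2.2.1) ?_ ?_)
        · rw [h2, ← h1]
        · rw [h4, ← h3]
  have h1 := hdraw.card_le
  have h2 : A.card ≤ (A \ X.image Prod.fst).card + (X.image Prod.fst).card := by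
    have := Finset.le_card_sdiff (X.image Prod.fst) A
    omega
  have h3 : (X.image Prod.fst).card ≤ X.card := Finset.card_image_le
  omega

theorem IsPseudoSegments.card_crossings_le (h : IsPseudoSegments L D f) :
    (crossings P L D f).card ≤ L.card ^ 2 := by
  rw [sq, ← Finset.card_product]
  refine Finset.card_le_card_of_injOn (fun c => (c.1.1, c.2.1)) ?_ ?_
  · rintro ⟨⟨l, p, q⟩, ⟨l', p', q'⟩⟩ hc
    obtain ⟨⟨h1, h2⟩, -⟩ := mem_crossings.1 hc
    exact Finset.mem_product.2 ⟨(mem_incidences.1 (mem_consecutive.1 h1).1).2.1,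
      (mem_incidences.1 (mem_consecutive.1 h2).1).2.1⟩
  · rintro ⟨⟨l, p, q⟩, ⟨l', p', q'⟩⟩ hc ⟨⟨m, r, s⟩, ⟨m', r', s'⟩⟩ hd heq
    obtain ⟨h1, h2⟩ := Prod.mk.inj heq
    simp only at h1 h2
    subst h1 h2
    obtain ⟨⟨c1, c2⟩, hne, x, hx, hx', hxe⟩ := mem_crossings.1 hc
    obtain ⟨⟨d1, d2⟩, -, y, hy, hy', hye⟩ := mem_crossings.1 hd
    simp only at *
    have i1 := h.mem_of_mem_consecutive c1 (Ioo_subset_Icc_self hx)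
    have i2 := h.mem_of_mem_consecutive c2 (Ioo_subset_Icc_self hx')
    have i3 := h.mem_of_mem_consecutive d1 (Ioo_subset_Icc_self hy)
    have i4 := h.mem_of_mem_consecutive d2 (Ioo_subset_Icc_self hy')
    have hxy : x = y := h.inter _ (mem_incidences.1 (mem_consecutive.1 c1).1).2.1 _
      (mem_incidences.1 (mem_consecutive.1 c2).1).2.1 hne x i1 i2 y i3 i4 hxe hye
    subst hxy
    obtain ⟨rfl, rfl⟩ := eq_of_mem_consecutive c1 d1 hx hy
    obtain ⟨rfl, rfl⟩ := eq_of_mem_consecutive c2 d2 hx' hy'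
    rfl

open Classical in
/-- Two crossing arcs have no end in common, as their curves meet in the crossing already. -/
theorem IsPseudoSegments.card_ends_of_mem_crossings (h : IsPseudoSegments L D f)
    {c : (α × (ℝ × ℝ) × (ℝ × ℝ)) × (α × (ℝ × ℝ) × (ℝ × ℝ))} (hc : c ∈ crossings P L D f) :
    ({c.1.2.1, c.1.2.2, c.2.2.1, c.2.2.2} : Finset (ℝ × ℝ)).card = 4 := by
  obtain ⟨⟨l, p, q⟩, ⟨l', p', q'⟩⟩ := c
  obtain ⟨⟨c1, c2⟩, hne, x, hx, hx', hxe⟩ := mem_crossings.1 hc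
  simp only at *
  obtain ⟨hp, hq, hpq, -⟩ := mem_consecutive.1 c1
  obtain ⟨hp', hq', hpq', -⟩ := mem_consecutive.1 c2
  have key : ∀ r, (r, l) ∈ incidences P L D f → (r, l') ∈ incidences P L D f → x = r.1 := by
    intro r hr hr'
    have i := mem_incidences.1 hr
    have i' := mem_incidences.1 hr'
    exact h.inter _ i.2.1 _ i'.2.1 hne x (h.mem_of_mem_consecutive c1 (Ioo_subset_Icc_self hx))
      (h.mem_of_mem_consecutive c2 (Ioo_subset_Icc_self hx')) _ i.2.2.1 i'.2.2.1 hxe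
      (i.2.2.2.trans i'.2.2.2.symm)
  have n1 : p ≠ q := by rintro rfl; exact lt_irrefl _ hpq
  have n2 : p' ≠ q' := by rintro rfl; exact lt_irrefl _ hpq'
  have n3 : p ≠ p' := by rintro rfl; exact hx.1.ne' (key _ hp hp')
  have n4 : p ≠ q' := by rintro rfl; exact hx.1.ne' (key _ hp hq')
  have n5 : q ≠ p' := by rintro rfl; exact hx.2.ne (key _ hq hp')
  have n6 : q ≠ q' := by rintro rfl; exact hx.2.ne (key _ hq hq')
  rw [Finset.card_insert_of_notMem (by simp [n1, n3, n4]),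
    Finset.card_insert_of_notMem (by simp [n5, n6]), Finset.card_pair n2]

end

/-! ### The Szemerédi–Trotter bound by random sampling -/

section

/-- If every element of `P` is chosen independently with probability `p`, then a given subset `T`
is contained in the chosen set with probability `p ^ #T`. -/
theorem sum_powerset_filter_superset {β : Type*} [DecidableEq β] {P T : Finset β} (hT : T ⊆ P)
    (p : ℝ) :
    ∑ S ∈ P.powerset.filter (T ⊆ ·), p ^ S.card * (1 - p) ^ (P.card - S.card) = p ^ T.card := by
  have hsum := Finset.sum_pow_mul_eq_add_pow p (1 - p) (P \ T)
  rw [add_sub_cancel, one_pow] at hsum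
  have hmul : p ^ T.card = ∑ U ∈ (P \ T).powerset,
      p ^ T.card * (p ^ U.card * (1 - p) ^ ((P \ T).card - U.card)) := by
    rw [← Finset.mul_sum, hsum, mul_one]
  rw [hmul]
  symm
  refine Finset.sum_bij' (fun U _ => T ∪ U) (fun S _ => S \ T) ?_ ?_ ?_ ?_ ?_
  · intro U hU
    rw [Finset.mem_powerset] at hU
    exact Finset.mem_filter.2 ⟨Finset.mem_powerset.2
      (Finset.union_subset hT (hU.trans Finset.sdiff_subset)), Finset.subset_union_left⟩
  · intro S hS
    rw [Finset.mem_filter, Finset.mem_powerset] at hS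
    exact Finset.mem_powerset.2 (Finset.sdiff_subset_sdiff hS.1 le_rfl)
  · intro U hU
    rw [Finset.mem_powerset] at hU
    exact Finset.union_sdiff_cancel_left (Finset.disjoint_of_subset_right hU Finset.disjoint_sdiff)
  · intro S hS
    rw [Finset.mem_filter] at hS
    exact Finset.union_sdiff_of_subset hS.2
  · intro U hU
    rw [Finset.mem_powerset] at hU
    rw [Finset.card_union_of_disjoint (Finset.disjoint_of_subset_right hU Finset.disjoint_sdiff),
      Finset.card_sdiff_of_subset hT, pow_add, mul_assoc, Nat.sub_sub]

/-- The expected number of the sets `T i` contained in a random subset of `P`. -/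
theorem sum_powerset_mul_card_filter {β ι : Type*} [DecidableEq β] {P : Finset β} (I : Finset ι)
    (T : ι → Finset β) {c : ℕ} (hT : ∀ i ∈ I, T i ⊆ P) (hc : ∀ i ∈ I, (T i).card = c) (p : ℝ) :
    ∑ S ∈ P.powerset, p ^ S.card * (1 - p) ^ (P.card - S.card) *
      ((I.filter fun i => T i ⊆ S).card : ℝ) = I.card * p ^ c := by
  calc _ = ∑ S ∈ P.powerset, ∑ i ∈ I,
        if T i ⊆ S then p ^ S.card * (1 - p) ^ (P.card - S.card) else 0 := by
        refine Finset.sum_congr rfl fun S _ => ?_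
        rw [← Finset.sum_filter, Finset.sum_const, nsmul_eq_mul, mul_comm]
    _ = ∑ i ∈ I, p ^ c := by
        rw [Finset.sum_comm]
        refine Finset.sum_congr rfl fun i hi => ?_
        rw [← Finset.sum_filter, sum_powerset_filter_superset (hT i hi), hc i hi]
    _ = _ := by rw [Finset.sum_const, nsmul_eq_mul]

variable {α : Type*} {P : Finset (ℝ × ℝ)} {L : Finset α} {D : α → Set ℝ} {f : α → ℝ → ℝ}

/-- The bound for the arcs with both ends in a random subset of `P`, in expectation. -/
theorem IsPseudoSegments.card_consecutive_mul_sq_le (h : IsPseudoSegments L D f) {p : ℝ}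
    (hp : 0 ≤ p) (hp1 : p ≤ 1) :
    (consecutive P L D f).card * p ^ 2 ≤ 3 * (P.card * p) + (L.card : ℝ) ^ 2 * p ^ 4 := by
  classical
  have e1 := sum_powerset_mul_card_filter (P := P) (c := 2) (consecutive P L D f)
    (fun e => {e.2.1, e.2.2}) (by
      rintro ⟨l, r, q⟩ he
      obtain ⟨h1, h2, -⟩ := mem_consecutive.1 he
      simp [Finset.insert_subset_iff, (mem_incidences.1 h1).1, (mem_incidences.1 h2).1]) (by
      rintro ⟨l, r, q⟩ he
      obtain ⟨h1, h2, h3, -⟩ := mem_consecutive.1 he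
      exact Finset.card_pair fun heq => h3.ne (congrArg Prod.fst heq)) p
  have e2 := sum_powerset_mul_card_filter (P := P) (c := 1) P (fun v => {v}) (by simp) (by simp) p
  have e3 := sum_powerset_mul_card_filter (P := P) (c := 4) (crossings P L D f)
    (fun c => {c.1.2.1, c.1.2.2, c.2.2.1, c.2.2.2}) (by
      rintro ⟨⟨l, r, q⟩, ⟨l', r', q'⟩⟩ hc
      obtain ⟨⟨h1, h2⟩, -⟩ := mem_crossings.1 hc
      obtain ⟨h1, h3, -⟩ := mem_consecutive.1 h1
      obtain ⟨h2, h4, -⟩ := mem_consecutive.1 h2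
      simp [Finset.insert_subset_iff, (mem_incidences.1 h1).1, (mem_incidences.1 h2).1,
        (mem_incidences.1 h3).1, (mem_incidences.1 h4).1])
    (fun c hc => h.card_ends_of_mem_crossings hc) p
  have hX : ((crossings P L D f).card : ℝ) ≤ (L.card : ℝ) ^ 2 := by
    exact_mod_cast h.card_crossings_le (P := P)
  have key : ((consecutive P L D f).card : ℝ) * p ^ 2 ≤
      3 * (P.card * p ^ 1) + (crossings P L D f).card * p ^ 4 := by
    rw [← e1, ← e2, ← e3, Finset.mul_sum, ← Finset.sum_add_distrib]
    refine Finset.sum_le_sum fun S hS => ?_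
    have hSP := Finset.mem_powerset.1 hS
    have hw : 0 ≤ p ^ S.card * (1 - p) ^ (P.card - S.card) :=
      mul_nonneg (pow_nonneg hp _) (pow_nonneg (sub_nonneg.2 hp1) _)
    have hfil : P.filter (fun v => {v} ⊆ S) = S := by
      ext v
      simp only [Finset.mem_filter, Finset.singleton_subset_iff]
      exact ⟨fun h => h.2, fun h => ⟨hSP h, h⟩⟩
    have hb := h.card_filter_consecutive_le hSP
    rw [hfil]
    calc _ ≤ p ^ S.card * (1 - p) ^ (P.card - S.card) * (((3 * S.card + _ : ℕ)) : ℝ) :=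
          mul_le_mul_of_nonneg_left (Nat.cast_le.2 hb) hw
      _ = _ := by push_cast; ring
  rw [pow_one] at key
  have := mul_le_mul_of_nonneg_right hX (pow_nonneg hp 4)
  linarith

/-- The Szemerédi–Trotter bound for pseudo-segments, for the number of arcs. -/
theorem IsPseudoSegments.card_consecutive_le (h : IsPseudoSegments L D f) :
    ((consecutive P L D f).card : ℝ) ≤ 6 * P.card ∨
      ((consecutive P L D f).card : ℝ) ^ 3 ≤ 72 * (P.card : ℝ) ^ 2 * (L.card : ℝ) ^ 2 := by
  rcases le_or_gt ((consecutive P L D f).card : ℝ) (6 * P.card) with h1 | h1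
  · exact Or.inl h1
  right
  have hv : (0 : ℝ) ≤ P.card := Nat.cast_nonneg _
  have he : (0 : ℝ) < (consecutive P L D f).card := by linarith
  rcases hv.eq_or_lt with hv0 | hv0
  · have hP : P = ∅ := by simpa using hv0.symm
    subst hP
    have h2 : consecutive (∅ : Finset (ℝ × ℝ)) L D f = ∅ := by simp [consecutive]
    rw [h2] at he
    simp at he
  -- With this probability the linear term is half of the left-hand side.
  have key := h.card_consecutive_mul_sq_le (P := P)
    (p := 6 * P.card / (consecutive P L D f).card) (by positivity) ((div_le_one he).2 h1.le)
  set e : ℝ := ((consecutive P L D f).card : ℝ)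
  set v : ℝ := (P.card : ℝ)
  set m : ℝ := (L.card : ℝ)
  have h2 : e * (6 * v / e) ^ 2 = 36 * v ^ 2 / e := by field_simp; ring
  have h3 : 3 * (v * (6 * v / e)) = 18 * v ^ 2 / e := by field_simp; ring
  have h4 : m ^ 2 * (6 * v / e) ^ 4 = (18 * v ^ 2 / e) * (72 * v ^ 2 * m ^ 2 / e ^ 3) := by
    field_simp; ring
  rw [h2, h3, h4] at key
  have hA : 0 < 18 * v ^ 2 / e := by positivity
  have h5 : 36 * v ^ 2 / e = 2 * (18 * v ^ 2 / e) := by ring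
  rw [h5] at key
  have h6 : 1 ≤ 72 * v ^ 2 * m ^ 2 / e ^ 3 := by
    by_contra! hcon
    nlinarith
  rwa [one_le_div (by positivity)] at h6

/-- The Szemerédi–Trotter bound for at most `n` points and at most `n` pseudo-segments. -/
theorem IsPseudoSegments.card_incidences_le_rpow (h : IsPseudoSegments L D f) {n : ℕ}
    (hP : P.card ≤ n) (hL : L.card ≤ n) :
    ((incidences P L D f).card : ℝ) ≤ 7 * (n : ℝ) ^ (4 / 3 : ℝ) := by
  have h1 : ((incidences P L D f).card : ℝ) ≤ (consecutive P L D f).card + L.card := by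
    exact_mod_cast card_incidences_le P L D f
  have hP' : (P.card : ℝ) ≤ n := by exact_mod_cast hP
  have hL' : (L.card : ℝ) ≤ n := by exact_mod_cast hL
  have hn : (n : ℝ) ≤ (n : ℝ) ^ (4 / 3 : ℝ) := by
    rcases Nat.eq_zero_or_pos n with rfl | hpos
    · simp [Real.zero_rpow]
    · exact Real.self_le_rpow_of_one_le (by exact_mod_cast hpos) (by norm_num)
  suffices ((consecutive P L D f).card : ℝ) ≤ 6 * (n : ℝ) ^ (4 / 3 : ℝ) by linarith
  rcases h.card_consecutive_le (P := P) with h2 | h2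
  · linarith
  · refine le_of_pow_le_pow_left₀ (n := 3) (by norm_num) (by positivity) (h2.trans ?_)
    have h3 : ((n : ℝ) ^ (4 / 3 : ℝ)) ^ 3 = (n : ℝ) ^ 4 := by
      rw [← Real.rpow_natCast, ← Real.rpow_mul (by positivity), ← Real.rpow_natCast (n : ℝ) 4]
      norm_num
    rw [mul_pow, h3]
    calc 72 * (P.card : ℝ) ^ 2 * (L.card : ℝ) ^ 2 ≤ 72 * (n : ℝ) ^ 2 * (n : ℝ) ^ 2 := by gcongr
      _ ≤ 6 ^ 3 * (n : ℝ) ^ 4 := by nlinarith [sq_nonneg ((n : ℝ) ^ 2)]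

end

/-! ### Equal distances and equal dot products in the plane -/

section
open Set

open Classical in
/-- The ordered pairs of distinct points of `E` at which `ρ` takes the value `c`. -/
noncomputable def valuePairs (ρ : Plane → Plane → ℝ) (c : ℝ) (E : Finset Plane) :
    Finset (Plane × Plane) :=
  (E ×ˢ E).filter fun q => q.1 ≠ q.2 ∧ ρ q.1 q.2 = c

open Classical in
/-- The triples `(x, y, z)` of points of `E` with `x ≠ z` such that `ρ` takes the value `c` at
`(x, y)` and `d` at `(y, z)`. -/
noncomputable def valueTriples (ρ : Plane → Plane → ℝ) (c d : ℝ) (E : Finset Plane) :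
    Finset (Plane × Plane × Plane) :=
  (E ×ˢ E ×ˢ E).filter fun q => q.1 ≠ q.2.2 ∧ ρ q.1 q.2.1 = c ∧ ρ q.2.1 q.2.2 = d

theorem mem_valuePairs {ρ : Plane → Plane → ℝ} {c : ℝ} {E : Finset Plane} {x y : Plane} :
    (x, y) ∈ valuePairs ρ c E ↔ x ∈ E ∧ y ∈ E ∧ x ≠ y ∧ ρ x y = c := by
  simp [valuePairs, and_assoc]

theorem mem_valueTriples {ρ : Plane → Plane → ℝ} {c d : ℝ} {E : Finset Plane} {x y z : Plane} :
    (x, y, z) ∈ valueTriples ρ c d E ↔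
      x ∈ E ∧ y ∈ E ∧ z ∈ E ∧ x ≠ z ∧ ρ x y = c ∧ ρ y z = d := by
  simp [valueTriples, and_assoc]

theorem plane_ext {x y : Plane} (h0 : x 0 = y 0) (h1 : x 1 = y 1) : x = y := by
  ext i
  fin_cases i
  · exact h0
  · exact h1

theorem plane_dist_sq (x y : Plane) : dist x y ^ 2 = (x 0 - y 0) ^ 2 + (x 1 - y 1) ^ 2 := by
  rw [EuclideanSpace.dist_eq, Real.sq_sqrt (by positivity), Fin.sum_univ_two, Real.dist_eq,
    Real.dist_eq, sq_abs, sq_abs]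

theorem plane_inner (x y : Plane) : inner ℝ x y = x 0 * y 0 + x 1 * y 1 := by
  simp [PiLp.inner_apply, Fin.sum_univ_two, mul_comm]

/-- The Szemerédi–Trotter bound for curves that are indexed by points of the plane. -/
theorem IsPseudoSegments.card_pairs_le {E L : Finset Plane} {Q : Finset (Plane × Plane)}
    {D : Plane → Set ℝ} {f : Plane → ℝ → ℝ} (h : IsPseudoSegments L D f)
    (hL : L.card ≤ E.card)
    (hQ : ∀ q ∈ Q, q.1 ∈ L ∧ q.2 ∈ E ∧ q.2 0 ∈ D q.1 ∧ f q.1 (q.2 0) = q.2 1) :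
    (Q.card : ℝ) ≤ 7 * (E.card : ℝ) ^ (4 / 3 : ℝ) := by
  classical
  have h1 := h.card_incidences_le_rpow (P := E.image fun p => (p 0, p 1)) (n := E.card)
    Finset.card_image_le hL
  refine le_trans ?_ h1
  rw [Nat.cast_le]
  refine Finset.card_le_card_of_injOn (fun q => ((q.2 0, q.2 1), q.1)) ?_ ?_
  · intro q hq
    obtain ⟨h1, h2, h3, h4⟩ := hQ q hq
    exact mem_incidences.2 ⟨Finset.mem_image.2 ⟨_, h2, rfl⟩, h1, h3, h4⟩
  · rintro ⟨x, y⟩ _ ⟨x', y'⟩ _ heq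
    simp only [Prod.mk.injEq] at heq
    rw [heq.2, plane_ext heq.1.1 heq.1.2]

/-- Two distinct upper semicircles of the same radius have at most one point in common. Indeed,
two points in common would have the same midpoint as the two centres; neither point being below a
centre, all four would have the same height, and then each centre would be that midpoint. -/
theorem eq_of_mem_upper_semicircles {p₀ p₁ q₀ q₁ u v s t d : ℝ}
    (h1 : (u - p₀) ^ 2 + (s - p₁) ^ 2 = d ^ 2) (h2 : (v - p₀) ^ 2 + (t - p₁) ^ 2 = d ^ 2)
    (h3 : (u - q₀) ^ 2 + (s - q₁) ^ 2 = d ^ 2) (h4 : (v - q₀) ^ 2 + (t - q₁) ^ 2 = d ^ 2)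
    (hs : p₁ ≤ s) (hs' : q₁ ≤ s) (ht : p₁ ≤ t) (ht' : q₁ ≤ t)
    (hne : ¬ (p₀ = q₀ ∧ p₁ = q₁)) : u = v := by
  by_contra huv
  have hA : u - v ≠ 0 := sub_ne_zero.2 huv
  have e1 : (u - v) * (u + v - p₀ - q₀) + (s - t) * (s + t - p₁ - q₁) = 0 := by
    linear_combination (h1 - h2 + h3 - h4) / 2
  have e2 : (p₀ - q₀) * (u - v) + (p₁ - q₁) * (s - t) = 0 := by
    linear_combination (h3 - h1 - h4 + h2) / 2
  have e3 : (p₀ - q₀) * (u + v - p₀ - q₀) + (p₁ - q₁) * (s + t - p₁ - q₁) = 0 := by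
    linear_combination (h3 - h1 + h4 - h2) / 2
  have e4 : ((p₁ - q₁) * (s + t - p₁ - q₁)) * ((u - v) ^ 2 + (s - t) ^ 2) = 0 := by
    linear_combination (u - v) ^ 2 * e3 - (u - v) * (u + v - p₀ - q₀) * e2 +
      (p₁ - q₁) * (s - t) * e1
  have hpos : (u - v) ^ 2 + (s - t) ^ 2 ≠ 0 := by positivity
  have hN : p₁ = q₁ := by
    rcases mul_eq_zero.1 ((mul_eq_zero.1 e4).resolve_right hpos) with h | h
    · linarith
    · linarith
  refine hne ⟨?_, hN⟩
  rw [hN, sub_self, zero_mul, add_zero] at e2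
  linarith [(mul_eq_zero.1 e2).resolve_right hA]

theorem isPseudoSegments_semicircles (L : Finset Plane) (d : ℝ) :
    IsPseudoSegments L (fun p => Icc (p 0 - d) (p 0 + d))
      (fun p t => p 1 + √(d ^ 2 - (t - p 0) ^ 2)) := by
  refine ⟨fun _ _ => ordConnected_Icc, fun _ _ => by fun_prop, ?_⟩
  intro p _ q _ hpq u hu hu' v hv hv' h1 h2
  have hsq : ∀ (p : Plane) (x : ℝ), x ∈ Icc (p 0 - d) (p 0 + d) →
      (x - p 0) ^ 2 + ((p 1 + √(d ^ 2 - (x - p 0) ^ 2)) - p 1) ^ 2 = d ^ 2 := by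
    intro p x hx
    have h0 : (x - p 0) ^ 2 ≤ d ^ 2 :=
      sq_le_sq' (by linarith [hx.1]) (by linarith [hx.2])
    rw [add_sub_cancel_left, Real.sq_sqrt (by linarith)]
    ring
  have hle : ∀ (p : Plane) (x : ℝ), p 1 ≤ p 1 + √(d ^ 2 - (x - p 0) ^ 2) := fun p x =>
    le_add_of_nonneg_right (Real.sqrt_nonneg _)
  simp only at h1 h2
  refine eq_of_mem_upper_semicircles (hsq p u hu) (hsq p v hv) (h1 ▸ hsq q u hu')
    (h2 ▸ hsq q v hv') (hle p u) (h1 ▸ hle q u) (hle p v) (h2 ▸ hle q v) ?_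
  rintro ⟨h3, h4⟩
  exact hpq (plane_ext h3 h4)

/-- The bound on the number of equal distances: for each pair, one of the two points lies on the
upper semicircle about the other one. -/
theorem card_valuePairs_dist_le (d : ℝ) (E : Finset Plane) :
    ((valuePairs (fun x y => dist x y) d E).card : ℝ) ≤ 14 * (E.card : ℝ) ^ (4 / 3 : ℝ) := by
  classical
  set Q := valuePairs (fun x y => dist x y) d E with hQ
  rcases le_or_gt d 0 with hd | hd
  · have hempty : Q = ∅ := by
      rw [Finset.eq_empty_iff_forall_notMem]
      rintro ⟨x, y⟩ hq
      obtain ⟨-, -, hne, hxy⟩ := mem_valuePairs.1 hq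
      have := dist_pos.2 hne
      linarith
    rw [hempty, Finset.card_empty, Nat.cast_zero]
    positivity
  have hup : ((Q.filter fun q => q.1 1 ≤ q.2 1).card : ℝ) ≤ 7 * (E.card : ℝ) ^ (4 / 3 : ℝ) := by
    refine (isPseudoSegments_semicircles E d).card_pairs_le le_rfl ?_
    rintro ⟨x, y⟩ hq
    obtain ⟨hq, hxy⟩ := Finset.mem_filter.1 hq
    obtain ⟨hx, hy, -, hdist⟩ := mem_valuePairs.1 hq
    have hsq := plane_dist_sq x y
    simp only at hdist hxy ⊢
    rw [hdist] at hsq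
    have habs : |y 0 - x 0| ≤ d := abs_le_of_sq_le_sq (by nlinarith) hd.le
    rw [abs_le] at habs
    refine ⟨hx, hy, ⟨by linarith, by linarith⟩, ?_⟩
    rw [show d ^ 2 - (y 0 - x 0) ^ 2 = (y 1 - x 1) ^ 2 by rw [hsq]; ring,
      Real.sqrt_sq (by linarith)]
    ring
  have hsub : Q ⊆ (Q.filter fun q => q.1 1 ≤ q.2 1) ∪
      (Q.filter fun q => q.1 1 ≤ q.2 1).image Prod.swap := by
    rintro ⟨x, y⟩ hq
    rw [Finset.mem_union]
    rcases le_total (x 1) (y 1) with h | h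
    · exact Or.inl (Finset.mem_filter.2 ⟨hq, h⟩)
    · refine Or.inr (Finset.mem_image.2 ⟨(y, x), Finset.mem_filter.2 ⟨?_, h⟩, rfl⟩)
      obtain ⟨hx, hy, hne, hdist⟩ := mem_valuePairs.1 hq
      exact mem_valuePairs.2 ⟨hy, hx, hne.symm, (dist_comm y x).trans hdist⟩
  have hcard : Q.card ≤ (Q.filter fun q => q.1 1 ≤ q.2 1).card +
      (Q.filter fun q => q.1 1 ≤ q.2 1).card :=
    (Finset.card_le_card hsub).trans ((Finset.card_union_le _ _).trans
      (Nat.add_le_add_left Finset.card_image_le _))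
  have hcard' : (Q.card : ℝ) ≤ (Q.filter fun q => q.1 1 ≤ q.2 1).card +
      (Q.filter fun q => q.1 1 ≤ q.2 1).card := by exact_mod_cast hcard
  linarith

/-- Given the two outer points, the middle one is an intersection point of two distinct circles. -/
theorem card_valueTriples_dist_le (c d : ℝ) (E : Finset Plane) :
    (valueTriples (fun x y => dist x y) c d E).card ≤ 2 * E.card ^ 2 := by
  classical
  rw [sq, ← Finset.card_product]
  refine Finset.card_le_mul_card_image_of_maps_to (f := fun q => (q.1, q.2.2)) ?_ 2 ?_
  · rintro ⟨x, y, z⟩ hq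
    obtain ⟨hx, -, hz, -⟩ := mem_valueTriples.1 hq
    exact Finset.mem_product.2 ⟨hx, hz⟩
  · rintro ⟨x, z⟩ -
    by_contra! hlt
    obtain ⟨q₁, h1, q₂, h2, q₃, h3, h12, h13, h23⟩ := Finset.two_lt_card.1 hlt
    obtain ⟨x₁, y₁, z₁⟩ := q₁
    obtain ⟨x₂, y₂, z₂⟩ := q₂
    obtain ⟨x₃, y₃, z₃⟩ := q₃
    simp only [Finset.mem_filter, Prod.mk.injEq, mem_valueTriples] at h1 h2 h3
    obtain ⟨⟨-, -, -, hne, a1, b1⟩, rfl, rfl⟩ := h1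
    obtain ⟨⟨-, -, -, -, a2, b2⟩, rfl, rfl⟩ := h2
    obtain ⟨⟨-, -, -, -, a3, b3⟩, rfl, rfl⟩ := h3
    have hy : y₁ ≠ y₂ := by rintro rfl; exact h12 rfl
    rw [dist_comm] at a1 a2 a3
    rcases EuclideanGeometry.eq_of_dist_eq_of_dist_eq_of_finrank_eq_two
      (by simp : Module.finrank ℝ Plane = 2) hne hy a1 a2 a3 b1 b2 b3 with h | h
    · exact h13 (by rw [h])
    · exact h23 (by rw [h])

theorem isPseudoSegments_lines {L : Finset Plane} (hL : ∀ p ∈ L, p 1 ≠ 0) {c : ℝ} (hc : c ≠ 0) :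
    IsPseudoSegments L (fun _ => univ) (fun p t => (c - p 0 * t) / p 1) := by
  refine ⟨fun _ _ => ordConnected_univ, fun _ _ => by fun_prop, ?_⟩
  intro p hp q hq hpq u _ _ v _ _ h1 h2
  have hp1 := hL p hp
  have hq1 := hL q hq
  by_contra huv
  have hv : ∀ (p : Plane) (t : ℝ), p 1 ≠ 0 → p 0 * t + p 1 * ((c - p 0 * t) / p 1) = c := by
    intro p t h
    field_simp
    ring
  have e1 := hv p u hp1
  have e2 := hv p v hp1
  have e3 := hv q u hq1
  have e4 := hv q v hq1
  simp only at h1 h2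
  rw [← h1] at e3
  rw [← h2] at e4
  generalize (c - p 0 * u) / p 1 = s at *
  generalize (c - p 0 * v) / p 1 = t at *
  have k1 : u * (p 0 * (p 1 - q 1) - p 1 * (p 0 - q 0)) = c * (p 1 - q 1) := by
    linear_combination (p 1 - q 1) * e1 - p 1 * (e1 - e3)
  have k2 : v * (p 0 * (p 1 - q 1) - p 1 * (p 0 - q 0)) = c * (p 1 - q 1) := by
    linear_combination (p 1 - q 1) * e2 - p 1 * (e2 - e4)
  have k3 : (u - v) * (p 0 * (p 1 - q 1) - p 1 * (p 0 - q 0)) = 0 := by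
    linear_combination k1 - k2
  rw [(mul_eq_zero.1 k3).resolve_left (sub_ne_zero.2 huv), mul_zero] at k1
  have hN : p 1 = q 1 := by linarith [(mul_eq_zero.1 k1.symm).resolve_left hc]
  have k4 : (u - v) * (p 0 - q 0) = 0 := by
    linear_combination e1 - e3 - e2 + e4 - (s - t) * hN
  have hM : p 0 = q 0 := by
    linarith [(mul_eq_zero.1 k4).resolve_left (sub_ne_zero.2 huv)]
  exact hpq (plane_ext hM hN)

/-- The bound on the number of equal dot products: the points `y` with `x · y = c` form a line,
and a vertical line of this kind is determined by any of its points. -/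
theorem card_valuePairs_inner_le {c : ℝ} (hc : c ≠ 0) (E : Finset Plane) :
    ((valuePairs (fun x y => inner ℝ x y) c E).card : ℝ) ≤ 8 * (E.card : ℝ) ^ (4 / 3 : ℝ) := by
  classical
  set Q := valuePairs (fun x y => inner ℝ x y) c E with hQ
  have h1 : ((Q.filter fun q => q.1 1 ≠ 0).card : ℝ) ≤ 7 * (E.card : ℝ) ^ (4 / 3 : ℝ) := by
    refine (isPseudoSegments_lines (L := E.filter fun p => p 1 ≠ 0)
      (fun p hp => (Finset.mem_filter.1 hp).2) hc).card_pairs_le (Finset.card_filter_le _ _) ?_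
    rintro ⟨x, y⟩ hq
    obtain ⟨hq, hx1⟩ := Finset.mem_filter.1 hq
    obtain ⟨hx, hy, -, hin⟩ := mem_valuePairs.1 hq
    simp only [plane_inner] at hin hx1 ⊢
    refine ⟨Finset.mem_filter.2 ⟨hx, hx1⟩, hy, mem_univ _, ?_⟩
    rw [div_eq_iff hx1]
    linarith
  have h2 : (Q.filter fun q => ¬ q.1 1 ≠ 0).card ≤ E.card := by
    refine Finset.card_le_card_of_injOn Prod.snd ?_ ?_
    · rintro ⟨x, y⟩ hq
      exact (mem_valuePairs.1 (Finset.mem_filter.1 hq).1).2.1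
    · rintro ⟨x, y⟩ hq ⟨x', y'⟩ hq' heq
      obtain rfl : y = y' := heq
      obtain ⟨hq, hx1⟩ := Finset.mem_filter.1 hq
      obtain ⟨hq', hx1'⟩ := Finset.mem_filter.1 hq'
      have e := (mem_valuePairs.1 hq).2.2.2
      have e' := (mem_valuePairs.1 hq').2.2.2
      simp only [plane_inner, ne_eq, not_not] at e e' hx1 hx1'
      rw [hx1, zero_mul, add_zero] at e
      rw [hx1', zero_mul, add_zero] at e'
      have hy : y 0 ≠ 0 := by
        intro h0
        rw [h0, mul_zero] at e
        exact hc e.symm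
      rw [plane_ext (mul_right_cancel₀ hy (e.trans e'.symm)) (hx1.trans hx1'.symm)]
  have h3 : (Q.card : ℝ) = (Q.filter fun q => q.1 1 ≠ 0).card +
      (Q.filter fun q => ¬ q.1 1 ≠ 0).card := by
    exact_mod_cast (Finset.card_filter_add_card_filter_not _).symm
  have h4 : ((Q.filter fun q => ¬ q.1 1 ≠ 0).card : ℝ) ≤ E.card := by exact_mod_cast h2
  have h5 : (E.card : ℝ) ≤ (E.card : ℝ) ^ (4 / 3 : ℝ) := by
    rcases Nat.eq_zero_or_pos E.card with h0 | hpos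
    · simp [h0, Real.zero_rpow]
    · exact Real.self_le_rpow_of_one_le (by exact_mod_cast hpos) (by norm_num)
  linarith

/-- The middle point is determined by the outer ones if these are linearly independent; otherwise
the third point is determined by the first two. -/
theorem card_valueTriples_inner_le {c : ℝ} (hc : c ≠ 0) (d : ℝ) (E : Finset Plane) :
    (valueTriples (fun x y => inner ℝ x y) c d E).card ≤ 2 * E.card ^ 2 := by
  classical
  set T := valueTriples (fun x y => inner ℝ x y) c d E with hT
  have h1 : (T.filter fun q => q.1 0 * q.2.2 1 - q.1 1 * q.2.2 0 ≠ 0).card ≤ E.card ^ 2 := by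
    rw [sq, ← Finset.card_product]
    refine Finset.card_le_card_of_injOn (fun q => (q.1, q.2.2)) ?_ ?_
    · rintro ⟨x, y, z⟩ hq
      obtain ⟨hx, -, hz, -⟩ := mem_valueTriples.1 (Finset.mem_filter.1 hq).1
      exact Finset.mem_product.2 ⟨hx, hz⟩
    · rintro ⟨x, y, z⟩ hq ⟨x', y', z'⟩ hq' heq
      obtain ⟨h1, h2⟩ := Prod.mk.inj heq
      simp only at h1 h2
      subst h1 h2
      obtain ⟨hq, hdet⟩ := Finset.mem_filter.1 hq
      obtain ⟨-, -, -, -, a1, b1⟩ := mem_valueTriples.1 hq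
      obtain ⟨-, -, -, -, a2, b2⟩ := mem_valueTriples.1 (Finset.mem_filter.1 hq').1
      simp only [plane_inner] at a1 a2 b1 b2 hdet
      have e0 : y 0 = y' 0 := by
        refine mul_left_cancel₀ hdet ?_
        linear_combination z 1 * (a1 - a2) - x 1 * (b1 - b2)
      have e1 : y 1 = y' 1 := by
        refine mul_left_cancel₀ hdet ?_
        linear_combination x 0 * (b1 - b2) - z 0 * (a1 - a2)
      rw [plane_ext e0 e1]
  have h2 : (T.filter fun q => ¬ q.1 0 * q.2.2 1 - q.1 1 * q.2.2 0 ≠ 0).card ≤ E.card ^ 2 := by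
    rw [sq, ← Finset.card_product]
    refine Finset.card_le_card_of_injOn (fun q => (q.1, q.2.1)) ?_ ?_
    · rintro ⟨x, y, z⟩ hq
      obtain ⟨hx, hy, -⟩ := mem_valueTriples.1 (Finset.mem_filter.1 hq).1
      exact Finset.mem_product.2 ⟨hx, hy⟩
    · rintro ⟨x, y, z⟩ hq ⟨x', y', z'⟩ hq' heq
      obtain ⟨h1, h2⟩ := Prod.mk.inj heq
      simp only at h1 h2
      subst h1 h2
      obtain ⟨hq, hdet⟩ := Finset.mem_filter.1 hq
      obtain ⟨hq', hdet'⟩ := Finset.mem_filter.1 hq'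
      obtain ⟨-, -, -, -, a1, b1⟩ := mem_valueTriples.1 hq
      obtain ⟨-, -, -, -, -, b2⟩ := mem_valueTriples.1 hq'
      simp only [plane_inner, ne_eq, not_not] at a1 b1 b2 hdet hdet'
      have e0 : z 0 = z' 0 := by
        refine mul_left_cancel₀ hc ?_
        linear_combination (z' 0 - z 0) * a1 - y 1 * (hdet - hdet') + x 0 * (b1 - b2)
      have e1 : z 1 = z' 1 := by
        refine mul_left_cancel₀ hc ?_
        linear_combination (z' 1 - z 1) * a1 + y 0 * (hdet - hdet') + x 1 * (b1 - b2)
      rw [plane_ext e0 e1]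
  have h3 := Finset.card_filter_add_card_filter_not (s := T)
    (fun q => q.1 0 * q.2.2 1 - q.1 1 * q.2.2 0 ≠ 0)
  omega

end

/-! ### Configurations of covered graphs -/

section

variable {V : Type*} [Fintype V]

open Classical in
/-- The injective placements of the vertices of `G` at points of `E` in which every edge has its
prescribed weight. -/
noncomputable def placements (ρ : Plane → Plane → ℝ) (G : SimpleGraph V) (w : G.edgeSet → ℝ)
    (E : Finset Plane) : Finset (V → Plane) :=
  (Fintype.piFinset fun _ => E).filter fun φ => Function.Injective φ ∧
    ∀ (u v : V) (h : G.Adj u v), w ⟨s(u, v), h⟩ = ρ (φ u) (φ v)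

theorem mem_placements {ρ : Plane → Plane → ℝ} {G : SimpleGraph V} {w : G.edgeSet → ℝ}
    {E : Finset Plane} {φ : V → Plane} :
    φ ∈ placements ρ G w E ↔ (∀ v, φ v ∈ E) ∧ Function.Injective φ ∧
      ∀ (u v : V) (h : G.Adj u v), w ⟨s(u, v), h⟩ = ρ (φ u) (φ v) := by
  simp [placements]

/-- Every configuration lists the points of a placement in some order. -/
theorem tupleCount_isConfiguration_le (ρ : Plane → Plane → ℝ) (G : SimpleGraph V)
    (w : G.edgeSet → ℝ) (E : Finset Plane) :
    tupleCount (IsConfiguration ρ G w) E ≤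
      (placements ρ G w E).card * Fintype.card V ^ Fintype.card V := by
  classical
  have hsub : {X : Fin (Fintype.card V) → Plane | (∀ i, X i ∈ E) ∧ IsConfiguration ρ G w X} ⊆
      (((placements ρ G w E) ×ˢ (Finset.univ : Finset (Fin (Fintype.card V) → V))).image
        (fun q i => q.1 (q.2 i)) : Finset (Fin (Fintype.card V) → Plane)) := by
    rintro X ⟨hXE, φ, hφ, hw⟩
    have hσ : ∀ i, ∃ v, φ v = X i := fun i => by
      obtain ⟨v, -, hv⟩ := hφ.surjOn ⟨i, rfl⟩
      exact ⟨v, hv⟩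
    choose σ hσ using hσ
    refine Finset.mem_coe.2 (Finset.mem_image.2 ⟨(φ, σ), ?_, funext hσ⟩)
    refine Finset.mem_product.2 ⟨mem_placements.2 ⟨fun v => ?_, ?_, hw⟩, Finset.mem_univ _⟩
    · obtain ⟨i, hi⟩ := hφ.mapsTo (Set.mem_univ v)
      have hXi := hXE i
      rwa [hi] at hXi
    · exact Set.injOn_univ.1 hφ.injOn
  have h1 := Set.ncard_le_ncard hsub (Finset.finite_toSet _)
  rw [Set.ncard_coe_finset] at h1
  refine h1.trans (Finset.card_image_le.trans ?_)
  rw [Finset.card_product, Finset.card_univ, Fintype.card_fun, Fintype.card_fin]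

/-- A placement is determined by its restrictions to the paths of a cover. -/
theorem card_placements_le {ρ : Plane → Plane → ℝ} {G : SimpleGraph V} {s t : ℕ}
    (hG : CanBeCovered G s t) {w : G.edgeSet → ℝ} {E : Finset Plane} {A B : ℝ}
    (hA : ∀ e, ((valuePairs ρ (w e) E).card : ℝ) ≤ A)
    (hB : ∀ e e', ((valueTriples ρ (w e) (w e') E).card : ℝ) ≤ B) :
    ((placements ρ G w E).card : ℝ) ≤ A ^ s * B ^ t := by
  classical
  obtain ⟨a, b, hab⟩ := hG
  have ha : ∀ i, G.Adj (a i 0) (a i 1) := fun i =>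
    (a i).toHom.map_adj (by simp [SimpleGraph.pathGraph_adj])
  have hb : ∀ j, G.Adj (b j 0) (b j 1) := fun j =>
    (b j).toHom.map_adj (by simp [SimpleGraph.pathGraph_adj])
  have hb' : ∀ j, G.Adj (b j 1) (b j 2) := fun j =>
    (b j).toHom.map_adj (by simp [SimpleGraph.pathGraph_adj])
  have hcard : (placements ρ G w E).card ≤
      (∏ i, (valuePairs ρ (w ⟨s(a i 0, a i 1), ha i⟩) E).card) *
      ∏ j, (valueTriples ρ (w ⟨s(b j 0, b j 1), hb j⟩) (w ⟨s(b j 1, b j 2), hb' j⟩) E).card := by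
    rw [← Fintype.card_piFinset, ← Fintype.card_piFinset, ← Finset.card_product]
    refine Finset.card_le_card_of_injOn (fun φ => (fun i => (φ (a i 0), φ (a i 1)),
      fun j => (φ (b j 0), φ (b j 1), φ (b j 2)))) ?_ ?_
    · intro φ hφ
      obtain ⟨hE, hinj, hw⟩ := mem_placements.1 hφ
      refine Finset.mem_product.2 ⟨Fintype.mem_piFinset.2 fun i => ?_,
        Fintype.mem_piFinset.2 fun j => ?_⟩
      · exact mem_valuePairs.2 ⟨hE _, hE _, hinj.ne (ha i).ne, (hw _ _ (ha i)).symm⟩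
      · refine mem_valueTriples.2 ⟨hE _, hE _, hE _, hinj.ne ((b j).injective.ne (by decide)),
          (hw _ _ (hb j)).symm, (hw _ _ (hb' j)).symm⟩
    · intro φ _ ψ _ heq
      obtain ⟨h1, h2⟩ := Prod.mk.inj heq
      funext v
      obtain ⟨q, rfl⟩ := hab.surjective v
      rcases q with ⟨i, m⟩ | ⟨j, m⟩
      · have h := Prod.mk.inj (congrFun h1 i)
        fin_cases m
        · exact h.1
        · exact h.2
      · have h := Prod.mk.inj (congrFun h2 j)
        have h' := Prod.mk.inj h.2
        fin_cases m
        · exact h.1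
        · exact h'.1
        · exact h'.2
  calc ((placements ρ G w E).card : ℝ) ≤ _ := Nat.cast_le.2 hcard
    _ ≤ A ^ s * B ^ t := by
      push_cast
      have hp1 : ∏ i : Fin s, ((valuePairs ρ (w ⟨s(a i 0, a i 1), ha i⟩) E).card : ℝ) ≤ A ^ s := by
        refine (Finset.prod_le_prod (fun _ _ => Nat.cast_nonneg _)
          fun i _ => hA _).trans ?_
        simp
      have hp2 : ∏ j : Fin t, ((valueTriples ρ (w ⟨s(b j 0, b j 1), hb j⟩)
          (w ⟨s(b j 1, b j 2), hb' j⟩) E).card : ℝ) ≤ B ^ t := by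
        refine (Finset.prod_le_prod (fun _ _ => Nat.cast_nonneg _)
          fun j _ => hB _ _).trans ?_
        simp
      exact mul_le_mul hp1 hp2 (Finset.prod_nonneg fun _ _ => Nat.cast_nonneg _)
        ((Finset.prod_nonneg fun _ _ => Nat.cast_nonneg _).trans hp1)

theorem maxTupleCount_isConfiguration_le {ρ : Plane → Plane → ℝ} {G : SimpleGraph V} {s t : ℕ}
    (hG : CanBeCovered G s t) {w : G.edgeSet → ℝ} {A B : ℝ}
    (hA : ∀ e E, ((valuePairs ρ (w e) E).card : ℝ) ≤ A * (E.card : ℝ) ^ (4 / 3 : ℝ))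
    (hB : ∀ e e' E, ((valueTriples ρ (w e) (w e') E).card : ℝ) ≤ B * (E.card : ℝ) ^ 2) (n : ℕ) :
    (maxTupleCount (IsConfiguration ρ G w) n : ℝ) ≤
      A ^ s * B ^ t * (Fintype.card V : ℝ) ^ Fintype.card V *
        (n : ℝ) ^ ((4 / 3 : ℝ) * s + 2 * t) := by
  obtain ⟨E, rfl, hE⟩ := (isGreatest_maxTupleCount (IsConfiguration ρ G w) n).1
  rw [← hE]
  have h1 := card_placements_le hG (fun e => hA e E) (fun e e' => hB e e' E)
  have h2 : (tupleCount (IsConfiguration ρ G w) E : ℝ) ≤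
      (placements ρ G w E).card * (Fintype.card V : ℝ) ^ Fintype.card V := by
    exact_mod_cast tupleCount_isConfiguration_le ρ G w E
  have h3 : (E.card : ℝ) ^ ((4 / 3 : ℝ) * s + 2 * t) =
      ((E.card : ℝ) ^ (4 / 3 : ℝ)) ^ s * ((E.card : ℝ) ^ 2) ^ t := by
    rw [Real.rpow_add_of_nonneg (by positivity) (by positivity) (by positivity),
      Real.rpow_mul (by positivity), Real.rpow_natCast, Real.rpow_mul (by positivity),
      Real.rpow_natCast, Real.rpow_two]
  rw [h3]
  calc _ ≤ _ := h2
    _ ≤ _ := mul_le_mul_of_nonneg_right h1 (by positivity)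
    _ = _ := by rw [mul_pow, mul_pow]; ring

end

theorem mainTheorem1 {V : Type*} [Fintype V] (G : SimpleGraph V) (s t : ℕ)
    (hG : CanBeCovered G s t) :
    (∃ (C : ℝ) (N : ℕ), ∀ (w : G.edgeSet → ℝ), ∀ n : ℕ, N < n →
      (maxDistConfigurations G w n : ℝ) ≤ C * (n : ℝ) ^ ((4 / 3 : ℝ) * s + 2 * t)) ∧
    (∃ (C : ℝ) (N : ℕ), ∀ (w : G.edgeSet → ℝ), (∀ e, w e ≠ 0) → ∀ n : ℕ, N < n →
      (maxDotConfigurations G w n : ℝ) ≤ C * (n : ℝ) ^ ((4 / 3 : ℝ) * s + 2 * t)) := by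
  constructor
  · refine ⟨14 ^ s * 2 ^ t * (Fintype.card V : ℝ) ^ Fintype.card V, 0, fun w n _ => ?_⟩
    refine maxTupleCount_isConfiguration_le hG (fun e E => card_valuePairs_dist_le _ E)
      (fun e e' E => ?_) n
    exact_mod_cast card_valueTriples_dist_le (w e) (w e') E
  · refine ⟨8 ^ s * 2 ^ t * (Fintype.card V : ℝ) ^ Fintype.card V, 0, fun w hw n _ => ?_⟩
    refine maxTupleCount_isConfiguration_le hG (fun e E => card_valuePairs_inner_le (hw e) E)
      (fun e e' E => ?_) n
    exact_mod_cast card_valueTriples_inner_le (hw e) (w e') E
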